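/- Let $d\ge 1$ and let $\Omega\subset\mathbb R^d$ be a bounded connected Lipschitz domain, i.e. a bounded, open, connected, nonempty set that is locally, near each boundary point and in suitable Cartesian coordinates, the set of points above the graph of a Lipschitz function. Let $A_{\min},A_{\max},\beta_{\min},\beta_{\max},V_{\min},V_{\max},k_0$ be positive constants. Then there is a constant $C_a>0$, depending only on $\Omega$ and these constants (in particular not on $k$; for $k_0=1$ this is a bound uniform in all $k\ge 1$), such that the following holds. Let $\partial\Omega=\overline{\Gamma_D\cup\Gamma_N\cup\Gamma_R}$ with pairwise disjoint measurable sets $\Gamma_D,\Gamma_N,\Gamma_R$, where $\Gamma_R$ has positive surface measure. Let $A$, $V$ be real-valued functions on $\Omega$ and $\beta$ a real-valued function on $\Gamma_R$, with $A$, $V^2$, $\beta$ measurable, such that $$A_{\min}\le A\le A_{\max},\qquad V_{\min}^2\le V^2\le V_{\max}^2\quad\text{a.e. in }\Omega,\qquad \beta_{\min}\le\beta\le\beta_{\max}\quad\text{a.e. on }\Gamma_R .$$ Let $k\ge k_0$, let $\mathcal V:=\{u\in H^1(\Omega;\mathbb C)\mid u=0\text{ on }\Gamma_D\text{ in the sense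 of traces}\}$, and define $$\|u\|_V:=\Big(\|kVu\|_{L^2(\Omega)}^2+\|A^{1/2}\nabla u\|_{L^2(\Omega)}^2\Big)^{1/2},$$ $$a(u,v):=\int_\Omega A\,\nabla u\cdot\nabla\bar v\,dx-\int_\Omega k^2V^2u\bar v\,dx-\int_{\Gamma_R} i k\beta\,u\bar v\,ds .$$ Then $$|a(u,v)|\le C_a\,\|u\|_V\,\|v\|_V\qquad\text{for all }u,v\in \mathcal V .$$ -/

import Mathlib

open MeasureTheory Filter Topology
open scoped ContDiff ComplexConjugate MeasureTheory

namespace Helmholtz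

/-- A bounded Lipschitz domain of `ℝ^d`: a bounded, open, connected, nonempty set which near each
of its boundary points is, for a suitable unit vector `e`, the set of points above the graph of a
Lipschitz function over the hyperplane orthogonal to `e`. (Here `inner ℝ e y` is the height of `y`
and `y - inner ℝ e y • e` is its projection to that hyperplane; only the values of `φ` on the
hyperplane matter.) -/
structure IsLipschitzDomain {d : ℕ} (Ω : Set (EuclideanSpace ℝ (Fin d))) : Prop where
  isOpen : IsOpen Ω
  isConnected : IsConnected Ω
  isBounded : Bornology.IsBounded Ω
  local_graph : ∀ x ∈ frontier Ω, ∃ e : EuclideanSpace ℝ (Fin d), ‖e‖ = 1 ∧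
    ∃ (K : NNReal) (φ : EuclideanSpace ℝ (Fin d) → ℝ), LipschitzWith K φ ∧
      ∃ r : ℝ, 0 < r ∧ ∀ y ∈ Metric.ball x r,
        (y ∈ Ω ↔ φ (y - inner ℝ e y • e) < inner ℝ e y)

/-- The surface measure `ds` on the boundary of `Ω`: the `(d-1)`-dimensional Hausdorff measure,
normalized as Lebesgue measure, restricted to the boundary. -/
noncomputable def surfaceMeasure {d : ℕ} (Ω : Set (EuclideanSpace ℝ (Fin d))) :
    Measure (EuclideanSpace ℝ (Fin d)) :=
  (Measure.euclideanHausdorffMeasure (d - 1)).restrict (frontier Ω)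

/-- The `i`-th classical partial derivative. -/
noncomputable def partialDeriv {d : ℕ} {F : Type*} [NormedAddCommGroup F] [NormedSpace ℝ F]
    (i : Fin d) (f : EuclideanSpace ℝ (Fin d) → F) (x : EuclideanSpace ℝ (Fin d)) : F :=
  fderiv ℝ f x (EuclideanSpace.single i 1)

/-- The complex Sobolev space `H¹(Ω)`: a square integrable function `val` on `Ω` (its values
outside of `Ω` play no role) together with its square integrable weak gradient `grad`, which is
determined by `val` almost everywhere on `Ω`. -/
structure H1 {d : ℕ} (Ω : Set (EuclideanSpace ℝ (Fin d))) where
  val : EuclideanSpace ℝ (Fin d) → ℂ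
  grad : EuclideanSpace ℝ (Fin d) → EuclideanSpace ℂ (Fin d)
  memLp_val : MemLp val 2 (volume.restrict Ω)
  memLp_grad : MemLp grad 2 (volume.restrict Ω)
  weak_grad : ∀ φ : EuclideanSpace ℝ (Fin d) → ℝ, ContDiff ℝ ∞ φ → HasCompactSupport φ →
    tsupport φ ⊆ Ω → ∀ i : Fin d,
      ∫ x in Ω, val x * ((partialDeriv i φ x : ℝ) : ℂ) = - ∫ x in Ω, grad x i * ((φ x : ℝ) : ℂ)

/-- `g ∈ L²(∂Ω)` is the boundary trace of `u ∈ H¹(Ω)`: there are smooth functions on `ℝ^d` that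
converge to `u` in `H¹(Ω)` and whose restrictions to the boundary converge to `g` in `L²(∂Ω)`. -/
def IsTrace {d : ℕ} {Ω : Set (EuclideanSpace ℝ (Fin d))} (u : H1 Ω)
    (g : EuclideanSpace ℝ (Fin d) → ℂ) : Prop :=
  MemLp g 2 (surfaceMeasure Ω) ∧
  ∃ w : ℕ → EuclideanSpace ℝ (Fin d) → ℂ,
    (∀ n, ContDiff ℝ ∞ (w n)) ∧
    Tendsto (fun n => eLpNorm (fun x => w n x - u.val x) 2 (volume.restrict Ω)) atTop (𝓝 0) ∧
    (∀ i : Fin d, Tendsto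
      (fun n => eLpNorm (fun x => partialDeriv i (w n) x - u.grad x i) 2 (volume.restrict Ω))
      atTop (𝓝 0)) ∧
    Tendsto (fun n => eLpNorm (fun x => w n x - g x) 2 (surfaceMeasure Ω)) atTop (𝓝 0)

open Classical in
/-- The boundary trace of `u ∈ H¹(Ω)`. By the trace theorem it exists and is unique almost
everywhere on the boundary if `Ω` is a bounded Lipschitz domain. -/
noncomputable def trace {d : ℕ} {Ω : Set (EuclideanSpace ℝ (Fin d))} (u : H1 Ω) :
    EuclideanSpace ℝ (Fin d) → ℂ :=
  if h : ∃ g, IsTrace u g then h.choose else 0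

/-- The boundary of `Ω` is the closure of the union of the disjoint (measurable) Dirichlet, Neumann
and Robin parts, and the Robin part has positive surface measure. -/
structure IsBoundaryDecomposition {d : ℕ} (Ω ΓD ΓN ΓR : Set (EuclideanSpace ℝ (Fin d))) :
    Prop where
  measurableSet_D : MeasurableSet ΓD
  measurableSet_N : MeasurableSet ΓN
  measurableSet_R : MeasurableSet ΓR
  disjoint_DN : Disjoint ΓD ΓN
  disjoint_DR : Disjoint ΓD ΓR
  disjoint_NR : Disjoint ΓN ΓR
  frontier_eq : frontier Ω = closure (ΓD ∪ ΓN ∪ ΓR)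
  robin_pos : 0 < surfaceMeasure Ω ΓR

/-- The space of all `u ∈ H¹(Ω)` with `u = 0` on `ΓD` in the sense of traces. -/
def spaceV {d : ℕ} (Ω ΓD : Set (EuclideanSpace ℝ (Fin d))) : Set (H1 Ω) :=
  {u | ∀ᵐ x ∂((surfaceMeasure Ω).restrict ΓD), trace u x = 0}

/-- The weighted norm `(‖k V u‖² + ‖A^{1/2} ∇u‖²)^{1/2}`, with norms of `L²(Ω)`. -/
noncomputable def normV {d : ℕ} {Ω : Set (EuclideanSpace ℝ (Fin d))}
    (A V : EuclideanSpace ℝ (Fin d) → ℝ) (k : ℝ) (u : H1 Ω) : ℝ :=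
  Real.sqrt ((∫ x in Ω, ‖((k * V x : ℝ) : ℂ) * u.val x‖ ^ 2)
    + ∫ x in Ω, ‖((Real.sqrt (A x) : ℝ) : ℂ) • u.grad x‖ ^ 2)

/-- The sesquilinear form
`a(u,v) = (A ∇u, ∇v)_{L²(Ω)} - (k² V² u, v)_{L²(Ω)} - (i k β u, v)_{L²(ΓR)}`. -/
noncomputable def form {d : ℕ} {Ω : Set (EuclideanSpace ℝ (Fin d))}
    (ΓR : Set (EuclideanSpace ℝ (Fin d)))
    (A V β : EuclideanSpace ℝ (Fin d) → ℝ) (k : ℝ) (u v : H1 Ω) : ℂ :=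
  (∫ x in Ω, (A x : ℂ) * ∑ i, u.grad x i * conj (v.grad x i))
    - (∫ x in Ω, ((k ^ 2 * V x ^ 2 : ℝ) : ℂ) * u.val x * conj (v.val x))
    - ∫ x in ΓR, Complex.I * ((k * β x : ℝ) : ℂ) * trace u x * conj (trace v x)
        ∂(surfaceMeasure Ω)

/-- The assumptions on the real coefficients: `A` and `V²` are measurable on `Ω` and `β` is
measurable on `ΓR`, with the given lower and upper bounds almost everywhere. -/
structure CoefficientBounds {d : ℕ} (Ω ΓR : Set (EuclideanSpace ℝ (Fin d)))
    (Amin Amax βmin βmax Vmin Vmax : ℝ) (A V β : EuclideanSpace ℝ (Fin d) → ℝ) : Prop where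
  aemeasurable_A : AEMeasurable A (volume.restrict Ω)
  aemeasurable_V : AEMeasurable (fun x => V x ^ 2) (volume.restrict Ω)
  aemeasurable_β : AEMeasurable β ((surfaceMeasure Ω).restrict ΓR)
  bounds_A : ∀ᵐ x ∂(volume.restrict Ω), Amin ≤ A x ∧ A x ≤ Amax
  bounds_V : ∀ᵐ x ∂(volume.restrict Ω), Vmin ^ 2 ≤ V x ^ 2 ∧ V x ^ 2 ≤ Vmax ^ 2
  bounds_β : ∀ᵐ x ∂((surfaceMeasure Ω).restrict ΓR), βmin ≤ β x ∧ β x ≤ βmax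

end Helmholtz

/-!
The first two terms of the form are bounded by the Cauchy–Schwarz inequality in `L²(Ω)`. The content
is the Robin term, which needs the multiplicative trace inequality

  `‖u‖²_{L²(∂Ω)} ≤ C (‖u‖²_{L²(Ω)} + ‖u‖_{L²(Ω)} ‖∇u‖_{L²(Ω)})`.

Multiplied by `k`, its right-hand side is controlled by `‖u‖_V²` uniformly in `k ≥ k₀`, because
`k Vmin ‖u‖` and `√Amin ‖∇u‖` are both at most `‖u‖_V`
(`IsLipschitzDomain.exists_trace_le_normV`).

By the definition of the trace it suffices to prove the trace inequality for smooth functions `w` on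
`ℝ^d` and to pass to the limit (`IsLipschitzDomain.exists_eLpNorm_trace_sq_le`). Density of smooth
functions in `H¹(Ω)` is not needed: the inequality is shown for every function that has a trace.

For smooth `w`, let `y` be a boundary point near which `Ω` lies above a Lipschitz graph in the
direction `e`. The segment from `y` to `y + h e` then lies in `Ω`, and integrating the derivative of
`(1 - t / h) |w (y + t e)|²` along it bounds `|w y|²` by the integral of `h⁻¹ |w|² + 2 |w| |∇w|` over
the segment (`enorm_sq_le_lintegral_segment`). Integrating this over the graph costs only a constant,
since the graph map is Lipschitz, so that the surface measure on the graph is at most a multiple of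
the volume of the hyperplane `eᗮ`, and since `eᗮ × ℝ ≃ ℝ^d` carries the product volume to a multiple
of Lebesgue measure (`lintegral_graph_le`). The boundary is compact, so finitely many graphs suffice
(`IsLipschitzDomain.exists_lintegral_surfaceMeasure_le`).
-/

namespace Helmholtz

open scoped ENNReal NNReal

/-! ### Smooth functions along segments -/

/-- A one-dimensional trace inequality: the value at an endpoint is controlled by the interval. -/
lemma norm_sq_le_integral {g g' : ℝ → ℂ} (hg : ∀ t, HasDerivAt g (g' t) t)
    (hg' : Continuous g') {h : ℝ} (hh : 0 < h) :
    ‖g 0‖ ^ 2 ≤ ∫ t in (0)..h, (h⁻¹ * ‖g t‖ ^ 2 + 2 * (‖g t‖ * ‖g' t‖)) := by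
  have hgc : Continuous g := continuous_iff_continuousAt.2 fun t => (hg t).continuousAt
  -- The weight `h⁻¹ t - 1` is `-1` at `0`, vanishes at `h`, and has absolute value at most `1`.
  have hd : ∀ t, HasDerivAt (fun t => (h⁻¹ * t - 1) * ‖g t‖ ^ 2)
      (h⁻¹ * ‖g t‖ ^ 2 + (h⁻¹ * t - 1) * (2 * inner ℝ (g t) (g' t))) t := fun t => by
    have h1 : HasDerivAt (fun t : ℝ => h⁻¹ * t - 1) h⁻¹ t := by
      simpa using ((hasDerivAt_id t).const_mul h⁻¹).sub_const 1
    exact h1.mul (hg t).norm_sq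
  have hcont : Continuous fun t =>
      h⁻¹ * ‖g t‖ ^ 2 + (h⁻¹ * t - 1) * (2 * inner ℝ (g t) (g' t)) := by fun_prop
  have hftc := intervalIntegral.integral_eq_sub_of_hasDerivAt (a := 0) (b := h)
    (fun t _ => hd t) (hcont.intervalIntegrable _ _)
  have h0 : ‖g 0‖ ^ 2 = ∫ t in (0)..h,
      (h⁻¹ * ‖g t‖ ^ 2 + (h⁻¹ * t - 1) * (2 * inner ℝ (g t) (g' t))) := by
    rw [hftc, inv_mul_cancel₀ hh.ne']; simp
  rw [h0]
  refine intervalIntegral.integral_mono_on hh.le (hcont.intervalIntegrable _ _)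
    (Continuous.intervalIntegrable (by fun_prop) _ _) fun t ht => ?_
  have h1 := abs_real_inner_le_norm (g t) (g' t)
  have h2 : |h⁻¹ * t - 1| ≤ 1 := by
    have : h⁻¹ * t ≤ 1 := by rw [inv_mul_le_iff₀ hh]; simpa using ht.2
    have : 0 ≤ h⁻¹ * t := mul_nonneg (by positivity) ht.1
    rw [abs_le]; constructor <;> linarith
  have h3 : (h⁻¹ * t - 1) * inner ℝ (g t) (g' t) ≤ ‖g t‖ * ‖g' t‖ := by
    refine (le_abs_self _).trans ?_
    rw [abs_mul]
    calc _ ≤ 1 * (‖g t‖ * ‖g' t‖) := by gcongr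
      _ = _ := one_mul _
  linarith

lemma norm_fderiv_apply_le_sum {d : ℕ} (w : EuclideanSpace ℝ (Fin d) → ℂ)
    {e : EuclideanSpace ℝ (Fin d)} (he : ‖e‖ = 1) (x : EuclideanSpace ℝ (Fin d)) :
    ‖fderiv ℝ w x e‖ ≤ ∑ i, ‖partialDeriv i w x‖ := by
  have h : e = ∑ i, e i • EuclideanSpace.single i (1 : ℝ) := by
    simpa using ((EuclideanSpace.basisFun (Fin d) ℝ).sum_repr e).symm
  conv_lhs => rw [h]
  rw [map_sum]
  refine (norm_sum_le _ _).trans (Finset.sum_le_sum fun i _ => ?_)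
  rw [map_smul, norm_smul]
  have : ‖e i‖ ≤ 1 := he ▸ PiLp.norm_apply_le e i
  exact mul_le_of_le_one_left (norm_nonneg _) this

lemma continuous_partialDeriv {d : ℕ} {w : EuclideanSpace ℝ (Fin d) → ℂ} (hw : ContDiff ℝ ∞ w)
    (i : Fin d) : Continuous (partialDeriv i w) :=
  (hw.continuous_fderiv (by simp)).clm_apply continuous_const

lemma enorm_sq_le_lintegral_segment {d : ℕ} {w : EuclideanSpace ℝ (Fin d) → ℂ}
    (hw : ContDiff ℝ ∞ w) {e : EuclideanSpace ℝ (Fin d)} (he : ‖e‖ = 1) {h : ℝ} (hh : 0 < h)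
    (y : EuclideanSpace ℝ (Fin d)) :
    ‖w y‖ₑ ^ 2 ≤ ∫⁻ t in Set.Ioo 0 h,
      ENNReal.ofReal (h⁻¹ + 2) * (‖w (y + t • e)‖ₑ ^ 2 +
        ‖w (y + t • e)‖ₑ * ∑ i, ‖partialDeriv i w (y + t • e)‖ₑ) := by
  have hwd : Differentiable ℝ w := hw.differentiable (by simp)
  have hline : ∀ t : ℝ, HasDerivAt (fun t : ℝ => y + t • e) e t := fun t => by
    simpa using ((hasDerivAt_id t).smul_const e).const_add y
  have hg : ∀ t : ℝ, HasDerivAt (fun t : ℝ => w (y + t • e)) (fderiv ℝ w (y + t • e) e) t :=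
    fun t => (hwd _).hasFDerivAt.comp_hasDerivAt t (hline t)
  have hwc := hw.continuous
  have hfc : Continuous (fderiv ℝ w) := hw.continuous_fderiv (by simp)
  have hg' : Continuous fun t : ℝ => fderiv ℝ w (y + t • e) e := by fun_prop
  have hpc := fun i => continuous_partialDeriv hw i
  have key := norm_sq_le_integral hg hg' hh
  simp only [zero_smul, add_zero] at key
  have h2 : ‖w y‖ ^ 2 ≤ ∫ t in Set.Ioo 0 h, (h⁻¹ + 2) * (‖w (y + t • e)‖ ^ 2 +
        ‖w (y + t • e)‖ * ∑ i, ‖partialDeriv i w (y + t • e)‖) := by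
    rw [← integral_Ioc_eq_integral_Ioo, ← intervalIntegral.integral_of_le hh.le]
    refine key.trans (intervalIntegral.integral_mono_on hh.le
      (Continuous.intervalIntegrable (by fun_prop) _ _)
      (Continuous.intervalIntegrable (by fun_prop) _ _) fun t _ => ?_)
    have h3 := norm_fderiv_apply_le_sum w he (y + t • e)
    have h4 : 0 ≤ ‖w (y + t • e)‖ := norm_nonneg _
    have h5 : 0 ≤ h⁻¹ := by positivity
    have h6 := mul_le_mul_of_nonneg_left h3 h4
    have h7 : 0 ≤ ‖w (y + t • e)‖ * ∑ i, ‖partialDeriv i w (y + t • e)‖ := by positivity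
    nlinarith [mul_nonneg h5 h7, sq_nonneg ‖w (y + t • e)‖]
  have h8 := ENNReal.ofReal_le_ofReal h2
  rw [ofReal_integral_eq_lintegral_ofReal] at h8
  · convert h8 using 3
    · rw [ENNReal.ofReal_pow (norm_nonneg _), ofReal_norm]
    · rw [ENNReal.ofReal_mul (by positivity),
        ENNReal.ofReal_add (p := ‖w _‖ ^ 2) (by positivity) (by positivity),
        ENNReal.ofReal_pow (norm_nonneg _), ENNReal.ofReal_mul (by positivity),
        ENNReal.ofReal_sum_of_nonneg fun i _ => norm_nonneg _]
      simp only [ofReal_norm]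
  · exact ((Continuous.integrableOn_Icc (a := 0) (b := h) (by fun_prop)).mono_set
      Set.Ioo_subset_Icc_self)
  · exact ae_of_all _ fun t => by positivity

/-! ### Integration over Lipschitz graphs and boundaries -/

/-- Surface measure on a piece `S` of a Lipschitz graph, spread along the segments of direction `e` and
length `h`, is at most a multiple of Lebesgue measure on any set `Ω` which contains these segments.
The constant depends on the direction and the graph function only. -/
lemma lintegral_graph_le {d : ℕ} {e : EuclideanSpace ℝ (Fin d)} (he : ‖e‖ = 1) {K : ℝ≥0}
    {φ : EuclideanSpace ℝ (Fin d) → ℝ} (hφ : LipschitzWith K φ) :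
    ∃ C : ℝ≥0, ∀ (S Ω : Set (EuclideanSpace ℝ (Fin d))) (h : ℝ),
      MeasurableSet S → MeasurableSet Ω →
      (∀ y ∈ S, φ (y - inner ℝ e y • e) = inner ℝ e y) →
      (∀ y ∈ S, ∀ t ∈ Set.Ioo 0 h, y + t • e ∈ Ω) →
      ∀ F : EuclideanSpace ℝ (Fin d) → ℝ≥0∞, Measurable F →
        ∫⁻ y in S, (∫⁻ t in Set.Ioo 0 h, F (y + t • e)) ∂(Measure.euclideanHausdorffMeasure (d - 1))
          ≤ C * ∫⁻ x in Ω, F x := by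
  have he0 : e ≠ 0 := by rintro rfl; simp at he
  have hee : inner ℝ e e = (1 : ℝ) := by rw [real_inner_self_eq_norm_sq, he]; norm_num
  set P : Submodule ℝ (EuclideanSpace ℝ (Fin d)) := (ℝ ∙ e)ᗮ with hP
  have hPe : ∀ p : P, inner ℝ e (p : EuclideanSpace ℝ (Fin d)) = (0 : ℝ) := fun p =>
    Submodule.mem_orthogonal_singleton_iff_inner_right.1 p.2
  have hrank : Module.finrank ℝ P = d - 1 := by
    have h1 := (ℝ ∙ e).finrank_add_finrank_orthogonal
    rw [finrank_span_singleton he0, finrank_euclideanSpace_fin] at h1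
    rw [hP]; omega
  -- The parametrization of the graph by the hyperplane `P`.
  set g : P → EuclideanSpace ℝ (Fin d) := fun p => p + φ p • e with hg
  have hgL : LipschitzWith (1 + K) g := by
    refine LipschitzWith.add (LipschitzWith.subtype_val _) ?_
    refine LipschitzWith.of_dist_le_mul fun p q => ?_
    rw [dist_eq_norm, ← sub_smul, norm_smul, he, mul_one, ← dist_eq_norm]
    exact hφ.dist_le_mul p q
  have hgm : Measurable g := hgL.continuous.measurable
  -- The coordinates `(p, t) ↦ p + t e`, a linear isomorphism, so that they map the product volume
  -- to a multiple `c` of Lebesgue measure, by uniqueness of Haar measure.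
  let Ψ : (P × ℝ) ≃L[ℝ] EuclideanSpace ℝ (Fin d) := LinearEquiv.toContinuousLinearEquiv
    { toFun := fun q => q.1 + q.2 • e
      invFun := fun y => (⟨y - inner ℝ e y • e, by
        rw [hP, Submodule.mem_orthogonal_singleton_iff_inner_right, inner_sub_right,
          inner_smul_right, hee]; simp⟩, inner ℝ e y)
      map_add' := fun a b => by simp [add_smul]; abel
      map_smul' := fun c a => by simp [mul_smul]
      left_inv := fun q => by
        ext1
        · ext1; simp [inner_add_right, inner_smul_right, hPe, he]
        · simp [inner_add_right, inner_smul_right, hPe, he]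
      right_inv := fun y => by simp }
  have hΨ : ∀ q, Ψ q = q.1 + q.2 • e := fun q => rfl
  have : (volume : Measure (P × ℝ)).IsAddHaarMeasure := by
    rw [Measure.volume_eq_prod]; infer_instance
  have : ((volume : Measure (P × ℝ)).map Ψ).IsAddHaarMeasure := Ψ.isAddHaarMeasure_map _
  have hmap : (volume : Measure (P × ℝ)).map Ψ =
      Measure.addHaarScalarFactor ((volume : Measure (P × ℝ)).map Ψ) volume • volume :=
    Measure.isAddLeftInvariant_eq_smul _ _
  set c := Measure.addHaarScalarFactor ((volume : Measure (P × ℝ)).map Ψ) volume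
  refine ⟨(1 + K) ^ (d - 1) * c, fun S Ω h hS hΩ hgraph hin F hF => ?_⟩
  have hFt : Measurable fun y => ∫⁻ t in Set.Ioo 0 h, F (y + t • e) :=
    Measurable.lintegral_prod_right' (f := fun z : EuclideanSpace ℝ (Fin d) × ℝ => F (z.1 + z.2 • e))
      (by fun_prop)
  -- On the graph, surface measure is dominated by the image of the volume of the hyperplane.
  have hmeas : (Measure.euclideanHausdorffMeasure (d - 1)).restrict S ≤
      ((1 + K) ^ (d - 1) : ℝ≥0) • ((volume.restrict (g ⁻¹' S)).map g) := by
    refine Measure.le_iff.2 fun E hE => ?_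
    rw [Measure.restrict_apply hE, Measure.smul_apply, Measure.map_apply hgm hE,
      Measure.restrict_apply (hgm hE), ← Set.preimage_inter]
    have hsub : E ∩ S ⊆ g '' (g ⁻¹' (E ∩ S)) := fun y hy => by
      refine ⟨(Ψ.symm y).1, ?_, ?_⟩
      all_goals
        have : g (Ψ.symm y).1 = y := by
          show (y - inner ℝ e y • e) + φ (y - inner ℝ e y • e) • e = y
          rw [hgraph y hy.2]; simp
      · simpa [this] using hy
      · exact this
    refine (measure_mono hsub).trans ?_
    rw [← InnerProductSpace.euclideanHausdorffMeasure_eq_volume, hrank,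
      Measure.euclideanHausdorffMeasure_def, Measure.euclideanHausdorffMeasure_def,
      Measure.smul_apply, Measure.smul_apply, smul_comm]
    gcongr
    refine (hgL.hausdorffMeasure_image_le (Nat.cast_nonneg _) _).trans (le_of_eq ?_)
    rw [ENNReal.rpow_natCast, ENNReal.smul_def, smul_eq_mul, ENNReal.coe_pow]
  calc ∫⁻ y in S, (∫⁻ t in Set.Ioo 0 h, F (y + t • e)) ∂(Measure.euclideanHausdorffMeasure (d - 1))
      ≤ ∫⁻ y, (∫⁻ t in Set.Ioo 0 h, F (y + t • e))
          ∂(((1 + K) ^ (d - 1) : ℝ≥0) • ((volume.restrict (g ⁻¹' S)).map g)) :=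
        lintegral_mono' hmeas le_rfl
    _ = ((1 + K) ^ (d - 1) : ℝ≥0) * ∫⁻ p in g ⁻¹' S, ∫⁻ t in Set.Ioo 0 h, F (g p + t • e) := by
        rw [lintegral_smul_measure, lintegral_map hFt hgm]; rfl
    _ ≤ ((1 + K) ^ (d - 1) : ℝ≥0) * ∫⁻ p : P, ∫⁻ s : ℝ, Ω.indicator F (Ψ (p, s)) := by
        refine mul_le_mul' le_rfl ?_
        rw [← lintegral_indicator (hgm hS)]
        refine lintegral_mono fun p => ?_
        -- The shift by `φ p` in the height turns `g p + t e` into `p + (φ p + t) e`.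
        by_cases hp : p ∈ g ⁻¹' S
        · rw [Set.indicator_of_mem hp, ← lintegral_indicator measurableSet_Ioo,
            
            ← lintegral_add_left_eq_self (fun s => Ω.indicator F (Ψ (p, s))) (φ p)]
          refine lintegral_mono fun t => ?_
          by_cases ht : t ∈ Set.Ioo 0 h
          · have h1 : Ψ (p, φ p + t) = g p + t • e := by rw [hΨ, hg]; simp [add_smul, add_assoc]
            rw [Set.indicator_of_mem ht, h1, Set.indicator_of_mem (hin _ hp _ ht)]
          · rw [Set.indicator_of_notMem ht]; exact zero_le
        · rw [Set.indicator_of_notMem hp]; exact zero_le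
    _ = ((1 + K) ^ (d - 1) : ℝ≥0) * ∫⁻ q : P × ℝ, Ω.indicator F (Ψ q) := by
        have hm : Measurable fun q : P × ℝ => Ω.indicator F (Ψ q) :=
          (hF.indicator hΩ).comp Ψ.continuous.measurable
        rw [Measure.volume_eq_prod, lintegral_prod _ hm.aemeasurable]
    _ = ((1 + K) ^ (d - 1) * c : ℝ≥0) * ∫⁻ x in Ω, F x := by
        rw [← lintegral_map (hF.indicator hΩ) Ψ.continuous.measurable, hmap,
          lintegral_smul_measure, lintegral_indicator hΩ, ENNReal.coe_mul, mul_assoc]; rfl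

/-- The trace inequality for smooth functions near a single boundary point. In a ball where `Ω` lies
above a graph, the boundary lies on that graph. -/
lemma IsLipschitzDomain.exists_ball_lintegral_le {d : ℕ} {Ω : Set (EuclideanSpace ℝ (Fin d))}
    (hΩ : IsLipschitzDomain Ω) {x : EuclideanSpace ℝ (Fin d)} (hx : x ∈ frontier Ω) :
    ∃ ρ > 0, ∃ C : ℝ≥0, ∀ w : EuclideanSpace ℝ (Fin d) → ℂ, ContDiff ℝ ∞ w →
      ∫⁻ y in frontier Ω ∩ Metric.ball x ρ, ‖w y‖ₑ ^ 2
          ∂(Measure.euclideanHausdorffMeasure (d - 1))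
        ≤ C * ∫⁻ y in Ω, (‖w y‖ₑ ^ 2 + ‖w y‖ₑ * ∑ i, ‖partialDeriv i w y‖ₑ) := by
  obtain ⟨e, he, K, φ, hφ, r, hr, hloc⟩ := hΩ.local_graph x hx
  have hee : inner ℝ e e = (1 : ℝ) := by rw [real_inner_self_eq_norm_sq, he]; norm_num
  obtain ⟨C, hC⟩ := lintegral_graph_le he hφ
  have hcont : Continuous fun y : EuclideanSpace ℝ (Fin d) => φ (y - inner ℝ e y • e) :=
    hφ.continuous.comp (by fun_prop)
  have hcont' : Continuous fun y : EuclideanSpace ℝ (Fin d) => (inner ℝ e y : ℝ) := by fun_prop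
  have hgraph : ∀ y ∈ frontier Ω ∩ Metric.ball x (r / 2),
      φ (y - inner ℝ e y • e) = inner ℝ e y := by
    rintro y ⟨hy, hyb⟩
    have hyr : y ∈ Metric.ball x r := Metric.ball_subset_ball (by linarith) hyb
    rw [hΩ.isOpen.frontier_eq] at hy
    refine le_antisymm ?_ ?_
    -- The inequality `≤` passes from `Ω` to its closure; `≥` holds because `y` is not in `Ω`.
    · have hcl : y ∈ closure (Ω ∩ Metric.ball x r) := by
        rw [Set.inter_comm]
        exact Metric.isOpen_ball.inter_closure ⟨hyr, hy.1⟩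
      refine closure_minimal (t := {y | φ (y - inner ℝ e y • e) ≤ inner ℝ e y}) ?_
        (isClosed_le hcont hcont') hcl
      exact fun z hz => ((hloc z hz.2).1 hz.1).le
    · exact not_lt.1 fun hlt => hy.2 ((hloc y hyr).2 hlt)
  have hin : ∀ y ∈ frontier Ω ∩ Metric.ball x (r / 2), ∀ t ∈ Set.Ioo 0 (r / 2),
      y + t • e ∈ Ω := by
    intro y hy t ht
    have hball : y + t • e ∈ Metric.ball x r := by
      rw [Metric.mem_ball]
      have h1 : dist (y + t • e) y = t := by
        rw [dist_eq_norm, add_sub_cancel_left, norm_smul, he, mul_one, Real.norm_eq_abs,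
          abs_of_pos ht.1]
      have h2 := Metric.mem_ball.1 hy.2
      have := dist_triangle (y + t • e) y x
      linarith [ht.2]
    refine (hloc _ hball).2 ?_
    have h3 : (inner ℝ e (y + t • e) : ℝ) = inner ℝ e y + t := by
      rw [inner_add_right, inner_smul_right, hee, mul_one]
    have h4 : y + t • e - (inner ℝ e y + t) • e = y - inner ℝ e y • e := by
      rw [add_smul]; abel
    rw [h3, h4, hgraph y hy]
    linarith [ht.1]
  have hr2 : 0 < r / 2 := by linarith
  refine ⟨r / 2, hr2, C * ((r / 2)⁻¹ + 2).toNNReal, fun w hw => ?_⟩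
  have hwc := hw.continuous
  have hpc := fun i => continuous_partialDeriv hw i
  have hm : Measurable fun y => ‖w y‖ₑ ^ 2 + ‖w y‖ₑ * ∑ i, ‖partialDeriv i w y‖ₑ := by
    have : ∀ i, Measurable (partialDeriv i w) := fun i => (hpc i).measurable
    have := hwc.measurable
    fun_prop
  refine (lintegral_mono fun y => enorm_sq_le_lintegral_segment hw he hr2 y).trans ?_
  have h5 := hC _ Ω (r / 2) (isClosed_frontier.measurableSet.inter measurableSet_ball)
    hΩ.isOpen.measurableSet hgraph hin
    (fun y => ENNReal.ofReal ((r / 2)⁻¹ + 2) *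
      (‖w y‖ₑ ^ 2 + ‖w y‖ₑ * ∑ i, ‖partialDeriv i w y‖ₑ)) (hm.const_mul _)
  refine h5.trans (le_of_eq ?_)
  rw [lintegral_const_mul _ hm, ENNReal.coe_mul, mul_assoc]; rfl

/-- The trace inequality for smooth functions, in integrated form. -/
lemma IsLipschitzDomain.exists_lintegral_surfaceMeasure_le {d : ℕ}
    {Ω : Set (EuclideanSpace ℝ (Fin d))} (hΩ : IsLipschitzDomain Ω) :
    ∃ C : ℝ≥0, ∀ w : EuclideanSpace ℝ (Fin d) → ℂ, ContDiff ℝ ∞ w →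
      ∫⁻ y, ‖w y‖ₑ ^ 2 ∂(surfaceMeasure Ω)
        ≤ C * ∫⁻ y in Ω, (‖w y‖ₑ ^ 2 + ‖w y‖ₑ * ∑ i, ‖partialDeriv i w y‖ₑ) := by
  have hcomp : IsCompact (frontier Ω) :=
    Metric.isCompact_of_isClosed_isBounded isClosed_frontier
      (hΩ.isBounded.closure.subset frontier_subset_closure)
  choose! ρ hρ C hC using fun x (hx : x ∈ frontier Ω) => hΩ.exists_ball_lintegral_le hx
  obtain ⟨T, hT, hcov⟩ := hcomp.elim_nhds_subcover (fun x => Metric.ball x (ρ x))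
    fun x hx => Metric.ball_mem_nhds x (hρ x hx)
  refine ⟨∑ x ∈ T, C x, fun w hw => ?_⟩
  have hsub : frontier Ω ⊆ ⋃ x ∈ T, frontier Ω ∩ Metric.ball x (ρ x) := fun y hy => by
    obtain ⟨x, hx, hyx⟩ := Set.mem_iUnion₂.1 (hcov hy)
    exact Set.mem_iUnion₂.2 ⟨x, hx, hy, hyx⟩
  calc ∫⁻ y, ‖w y‖ₑ ^ 2 ∂(surfaceMeasure Ω)
      ≤ ∫⁻ y in ⋃ x ∈ T, frontier Ω ∩ Metric.ball x (ρ x), ‖w y‖ₑ ^ 2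
          ∂(Measure.euclideanHausdorffMeasure (d - 1)) := lintegral_mono_set hsub
    _ ≤ ∑ x ∈ T, ∫⁻ y in frontier Ω ∩ Metric.ball x (ρ x), ‖w y‖ₑ ^ 2
          ∂(Measure.euclideanHausdorffMeasure (d - 1)) := by
        rw [← lintegral_finsetSum_measure]
        refine lintegral_mono' (Measure.le_iff.2 fun E hE => ?_) le_rfl
        rw [Measure.restrict_apply hE, Measure.finsetSum_apply, Set.inter_iUnion₂]
        simp only [Measure.restrict_apply hE]
        exact measure_biUnion_finset_le _ _
    _ ≤ ∑ x ∈ T, C x * ∫⁻ y in Ω, (‖w y‖ₑ ^ 2 + ‖w y‖ₑ * ∑ i, ‖partialDeriv i w y‖ₑ) :=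
        Finset.sum_le_sum fun x hx => hC x (hT x hx) w hw
    _ = _ := by rw [← Finset.sum_mul, ENNReal.ofNNReal_finsetSum]

/-! ### Square integrable functions -/

section L2
variable {α E F : Type*} [MeasurableSpace α] {μ : Measure α} [NormedAddCommGroup E]
  [NormedAddCommGroup F]

lemma eLpNorm_two_sq_eq_lintegral (f : α → E) :
    eLpNorm f 2 μ ^ 2 = ∫⁻ x, ‖f x‖ₑ ^ 2 ∂μ := by
  simpa using eLpNorm_nnreal_pow_eq_lintegral (p := 2) (f := f) (μ := μ) two_ne_zero

lemma toReal_eLpNorm_two_sq {f : α → E} (hf : MemLp f 2 μ) :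
    (eLpNorm f 2 μ).toReal ^ 2 = ∫ x, ‖f x‖ ^ 2 ∂μ := by
  rw [← ENNReal.toReal_pow, eLpNorm_two_sq_eq_lintegral, ← integral_toReal]
  · simp
  · exact hf.1.enorm.pow_const 2
  · have h : ∫⁻ x, ‖f x‖ₑ ^ 2 ∂μ ≠ ⊤ := by
      rw [← eLpNorm_two_sq_eq_lintegral]; exact ENNReal.pow_ne_top hf.2.ne
    exact ae_lt_top' (hf.1.enorm.pow_const 2) h

lemma lintegral_enorm_mul_enorm_le {f : α → E} {g : α → F} (hf : AEStronglyMeasurable f μ)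
    (hg : AEStronglyMeasurable g μ) :
    ∫⁻ x, ‖f x‖ₑ * ‖g x‖ₑ ∂μ ≤ eLpNorm f 2 μ * eLpNorm g 2 μ := by
  have h := ENNReal.lintegral_mul_le_Lp_mul_Lq μ Real.HolderConjugate.two_two hf.enorm hg.enorm
  simpa [eLpNorm_eq_lintegral_rpow_enorm_toReal] using h

lemma tendsto_eLpNorm_of_tendsto_sub {f : ℕ → α → E} {g : α → E}
    (hf : ∀ n, AEStronglyMeasurable (f n) μ) (hg : MemLp g 2 μ)
    (h : Tendsto (fun n => eLpNorm (fun x => f n x - g x) 2 μ) atTop (𝓝 0)) :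
    Tendsto (fun n => eLpNorm (f n) 2 μ) atTop (𝓝 (eLpNorm g 2 μ)) := by
  have hlow : Tendsto (fun n => eLpNorm g 2 μ - eLpNorm (fun x => f n x - g x) 2 μ) atTop
      (𝓝 (eLpNorm g 2 μ)) := by
    simpa using ENNReal.Tendsto.sub (tendsto_const_nhds (x := eLpNorm g 2 μ)) h (.inl hg.2.ne)
  have hup : Tendsto (fun n => eLpNorm (fun x => f n x - g x) 2 μ + eLpNorm g 2 μ) atTop
      (𝓝 (eLpNorm g 2 μ)) := by
    simpa using h.add (tendsto_const_nhds (x := eLpNorm g 2 μ))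
  refine tendsto_of_tendsto_of_tendsto_of_le_of_le hlow hup (fun n => ?_) fun n => ?_
  · refine tsub_le_iff_right.2 ?_
    have h1 := eLpNorm_sub_le (hf n) ((hf n).sub hg.1) (p := 2) (by norm_num)
    simpa [Pi.sub_def] using h1
  · have h1 := eLpNorm_add_le ((hf n).sub hg.1) hg.1 (p := 2) (by norm_num)
    simpa [Pi.sub_def, Pi.add_def] using h1

/-- Cauchy–Schwarz with pointwise majorants; the integrand `h` itself need not be measurable. -/
lemma norm_integral_le_sqrt_mul_sqrt {h : α → ℂ} {f g : α → ℝ} (hf : MemLp f 2 μ)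
    (hg : MemLp g 2 μ) (hf0 : ∀ x, 0 ≤ f x) (hg0 : ∀ x, 0 ≤ g x)
    (hle : ∀ᵐ x ∂μ, ‖h x‖ ≤ f x * g x) :
    ‖∫ x, h x ∂μ‖ ≤ √(∫ x, f x ^ 2 ∂μ) * √(∫ x, g x ^ 2 ∂μ) := by
  refine (norm_integral_le_of_norm_le (hf.integrable_mul hg) hle).trans ?_
  have := integral_mul_le_Lp_mul_Lq_of_nonneg (μ := μ) Real.HolderConjugate.two_two
    (ae_of_all _ hf0) (ae_of_all _ hg0) (by simpa using hf) (by simpa using hg)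
  simpa [Real.sqrt_eq_rpow] using this

end L2

/-! ### The trace inequality in `H¹(Ω)` -/

variable {d : ℕ} {Ω : Set (EuclideanSpace ℝ (Fin d))}

lemma H1.memLp_grad_apply (u : H1 Ω) (i : Fin d) :
    MemLp (fun x => u.grad x i) 2 (volume.restrict Ω) :=
  u.memLp_grad.of_le
    ((EuclideanSpace.proj (𝕜 := ℂ) i).continuous.comp_aestronglyMeasurable u.memLp_grad.1)
    (ae_of_all _ fun x => PiLp.norm_apply_le (u.grad x) i)

lemma eLpNorm_sq_surfaceMeasure_le {C : ℝ≥0} {w : EuclideanSpace ℝ (Fin d) → ℂ}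
    (hw : ContDiff ℝ ∞ w) (h : ∫⁻ y, ‖w y‖ₑ ^ 2 ∂(surfaceMeasure Ω)
        ≤ C * ∫⁻ y in Ω, (‖w y‖ₑ ^ 2 + ‖w y‖ₑ * ∑ i, ‖partialDeriv i w y‖ₑ)) :
    eLpNorm w 2 (surfaceMeasure Ω) ^ 2 ≤ C * (eLpNorm w 2 (volume.restrict Ω) ^ 2 +
      eLpNorm w 2 (volume.restrict Ω) * ∑ i, eLpNorm (partialDeriv i w) 2 (volume.restrict Ω)) := by
  have hwm := hw.continuous.measurable
  have hpm := fun i => (continuous_partialDeriv hw i).measurable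
  rw [eLpNorm_two_sq_eq_lintegral]
  refine h.trans (mul_le_mul' le_rfl ?_)
  rw [lintegral_add_left (by fun_prop), eLpNorm_two_sq_eq_lintegral]
  simp only [Finset.mul_sum]
  rw [lintegral_finsetSum _ (by fun_prop)]
  gcongr with i
  exact lintegral_enorm_mul_enorm_le hwm.aestronglyMeasurable (hpm i).aestronglyMeasurable

/-- The multiplicative trace inequality. It is closed under the simultaneous limits in `H¹(Ω)` and
`L²(∂Ω)` which define traces. -/
lemma IsLipschitzDomain.exists_eLpNorm_trace_sq_le (hΩ : IsLipschitzDomain Ω) :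
    ∃ C : ℝ≥0, ∀ u : H1 Ω, MemLp (trace u) 2 (surfaceMeasure Ω) ∧
      eLpNorm (trace u) 2 (surfaceMeasure Ω) ^ 2 ≤ C * (eLpNorm u.val 2 (volume.restrict Ω) ^ 2 +
        eLpNorm u.val 2 (volume.restrict Ω) * (d * eLpNorm u.grad 2 (volume.restrict Ω))) := by
  obtain ⟨C, hC⟩ := hΩ.exists_lintegral_surfaceMeasure_le
  refine ⟨C, fun u => ?_⟩
  by_cases hu : ∃ g, IsTrace u g
  · have htr : IsTrace u (trace u) := by
      rw [trace, dif_pos hu]; exact hu.choose_spec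
    obtain ⟨hmem, w, hw, hwu, hwgrad, hwtr⟩ := htr
    refine ⟨hmem, ?_⟩
    have h1 := tendsto_eLpNorm_of_tendsto_sub
      (fun n => (hw n).continuous.aestronglyMeasurable) u.memLp_val hwu
    have h2 := fun i => tendsto_eLpNorm_of_tendsto_sub
      (fun n => (continuous_partialDeriv (hw n) i).aestronglyMeasurable)
      (u.memLp_grad_apply i) (hwgrad i)
    have h3 := tendsto_eLpNorm_of_tendsto_sub
      (fun n => (hw n).continuous.aestronglyMeasurable) hmem hwtr
    have h4 := tendsto_finsetSum Finset.univ fun i _ => h2 i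
    have hsum : ∑ i, eLpNorm (fun x => u.grad x i) 2 (volume.restrict Ω) ≠ ⊤ :=
      ENNReal.sum_ne_top.2 fun i _ => (u.memLp_grad_apply i).2.ne
    have h5 := ENNReal.Tendsto.const_mul (a := (C : ℝ≥0∞)) ((ENNReal.Tendsto.pow (n := 2) h1).add
      (ENNReal.Tendsto.mul h1 (.inr hsum) h4 (.inr u.memLp_val.2.ne))) (.inr ENNReal.coe_ne_top)
    refine (le_of_tendsto_of_tendsto' (ENNReal.Tendsto.pow (n := 2) h3) h5 fun n =>
      eLpNorm_sq_surfaceMeasure_le (hw n) (hC _ (hw n))).trans ?_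
    gcongr
    calc ∑ i, eLpNorm (fun x => u.grad x i) 2 (volume.restrict Ω)
        ≤ ∑ _i : Fin d, eLpNorm u.grad 2 (volume.restrict Ω) := Finset.sum_le_sum fun i _ =>
          eLpNorm_mono fun x => PiLp.norm_apply_le (u.grad x) i
      _ = d * eLpNorm u.grad 2 (volume.restrict Ω) := by simp
  -- Without a trace `trace u` is `0` by convention, for which the bound is trivial. (By the trace
  -- theorem this case does not occur, but that is not needed.)
  · rw [trace, dif_neg hu]
    simp

/-- The multiplicative trace inequality, for real integrals. -/
lemma IsLipschitzDomain.exists_integral_norm_trace_sq_le (hΩ : IsLipschitzDomain Ω) :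
    ∃ C : ℝ, 0 ≤ C ∧ ∀ u : H1 Ω, MemLp (trace u) 2 (surfaceMeasure Ω) ∧
      ∫ x, ‖trace u x‖ ^ 2 ∂(surfaceMeasure Ω) ≤ C * ((∫ x in Ω, ‖u.val x‖ ^ 2) +
        √(∫ x in Ω, ‖u.val x‖ ^ 2) * √(∫ x in Ω, ‖u.grad x‖ ^ 2)) := by
  obtain ⟨C, hC⟩ := hΩ.exists_eLpNorm_trace_sq_le
  refine ⟨C * (1 + d), by positivity, fun u => ⟨(hC u).1, ?_⟩⟩
  have hu := u.memLp_val.2.ne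
  have hg := u.memLp_grad.2.ne
  have h := ENNReal.toReal_mono (by finiteness) (hC u).2
  rw [ENNReal.toReal_pow, toReal_eLpNorm_two_sq (hC u).1, ENNReal.toReal_mul,
    ENNReal.toReal_add (by finiteness) (by finiteness)] at h
  simp only [ENNReal.toReal_mul, ENNReal.toReal_pow, ENNReal.coe_toReal,
    ENNReal.toReal_natCast] at h
  rw [← toReal_eLpNorm_two_sq u.memLp_val, ← toReal_eLpNorm_two_sq u.memLp_grad,
    Real.sqrt_sq ENNReal.toReal_nonneg, Real.sqrt_sq ENNReal.toReal_nonneg]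
  set U := (eLpNorm u.val 2 (volume.restrict Ω)).toReal with hU
  set G := (eLpNorm u.grad 2 (volume.restrict Ω)).toReal with hG
  have hU0 : 0 ≤ U := ENNReal.toReal_nonneg
  have hG0 : 0 ≤ G := ENNReal.toReal_nonneg
  refine h.trans ?_
  rw [mul_assoc]
  have hd : (0 : ℝ) ≤ d := by positivity
  gcongr
  nlinarith [mul_nonneg hU0 hG0, mul_nonneg hd (sq_nonneg U)]

/-! ### The weighted norm -/

variable {ΓR : Set (EuclideanSpace ℝ (Fin d))}
  {Amin Amax βmin βmax Vmin Vmax : ℝ} {A V β : EuclideanSpace ℝ (Fin d) → ℝ} {k : ℝ}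

lemma CoefficientBounds.memLp_sqrt_smul_grad
    (hc : CoefficientBounds Ω ΓR Amin Amax βmin βmax Vmin Vmax A V β) (u : H1 Ω) :
    MemLp (fun x => ‖((√(A x) : ℝ) : ℂ) • u.grad x‖) 2 (volume.restrict Ω) := by
  have hA : AEStronglyMeasurable (fun x => ((√(A x) : ℝ) : ℂ)) (volume.restrict Ω) :=
    (Complex.measurable_ofReal.comp_aemeasurable hc.aemeasurable_A.sqrt).aestronglyMeasurable
  refine (u.memLp_grad.of_le_mul (c := √Amax) (hA.smul u.memLp_grad.1) ?_).norm
  filter_upwards [hc.bounds_A] with x hx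
  rw [Pi.smul_apply', norm_smul, Complex.norm_real, Real.norm_of_nonneg (Real.sqrt_nonneg _)]
  gcongr
  exact hx.2

/-- Only `V ^ 2` is assumed to be measurable, so that `|V|` has to be written as `√(V ^ 2)`. -/
lemma norm_mul_val_eq (hk : 0 ≤ k) (z : ℂ) (v : ℝ) :
    ‖((k * v : ℝ) : ℂ) * z‖ = k * √(v ^ 2) * ‖z‖ := by
  rw [norm_mul, Complex.norm_real, norm_mul, Real.norm_of_nonneg hk, Real.sqrt_sq_eq_abs,
    Real.norm_eq_abs]

lemma CoefficientBounds.memLp_mul_val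
    (hc : CoefficientBounds Ω ΓR Amin Amax βmin βmax Vmin Vmax A V β) (hk : 0 ≤ k) (u : H1 Ω) :
    MemLp (fun x => ‖((k * V x : ℝ) : ℂ) * u.val x‖) 2 (volume.restrict Ω) := by
  simp_rw [norm_mul_val_eq hk]
  have hm : AEStronglyMeasurable (fun x => k * √(V x ^ 2) * ‖u.val x‖) (volume.restrict Ω) :=
    ((hc.aemeasurable_V.sqrt.const_mul k).mul u.memLp_val.1.norm.aemeasurable).aestronglyMeasurable
  refine u.memLp_val.of_le_mul (c := k * √(Vmax ^ 2)) hm ?_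
  filter_upwards [hc.bounds_V] with x hx
  rw [Real.norm_of_nonneg (by positivity)]
  have h := Real.sqrt_le_sqrt hx.2
  gcongr

lemma CoefficientBounds.integral_val_sq_le
    (hc : CoefficientBounds Ω ΓR Amin Amax βmin βmax Vmin Vmax A V β) (hk : 0 ≤ k) (u : H1 Ω) :
    k ^ 2 * Vmin ^ 2 * ∫ x in Ω, ‖u.val x‖ ^ 2 ≤ ∫ x in Ω, ‖((k * V x : ℝ) : ℂ) * u.val x‖ ^ 2 := by
  rw [← integral_const_mul]
  have h1 := u.memLp_val.norm.integrable_sq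
  refine integral_mono_ae (h1.const_mul _) (hc.memLp_mul_val hk u).integrable_sq ?_
  filter_upwards [hc.bounds_V] with x hx
  rw [norm_mul_val_eq hk, mul_pow, mul_pow, Real.sq_sqrt (sq_nonneg _)]
  have h := hx.1
  gcongr ?_ * _
  exact mul_le_mul_of_nonneg_left h (sq_nonneg k)

lemma CoefficientBounds.integral_grad_sq_le (hA0 : 0 < Amin)
    (hc : CoefficientBounds Ω ΓR Amin Amax βmin βmax Vmin Vmax A V β) (u : H1 Ω) :
    Amin * ∫ x in Ω, ‖u.grad x‖ ^ 2 ≤ ∫ x in Ω, ‖((√(A x) : ℝ) : ℂ) • u.grad x‖ ^ 2 := by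
  rw [← integral_const_mul]
  have h1 := u.memLp_grad.norm.integrable_sq
  refine integral_mono_ae (h1.const_mul _) (hc.memLp_sqrt_smul_grad u).integrable_sq ?_
  filter_upwards [hc.bounds_A] with x hx
  rw [norm_smul, Complex.norm_real, Real.norm_of_nonneg (Real.sqrt_nonneg _), mul_pow,
    Real.sq_sqrt (hA0.le.trans hx.1)]
  gcongr
  exact hx.1

lemma sqrt_val_le_normV (u : H1 Ω) :
    √(∫ x in Ω, ‖((k * V x : ℝ) : ℂ) * u.val x‖ ^ 2) ≤ normV A V k u :=
  Real.sqrt_le_sqrt (le_add_of_nonneg_right (integral_nonneg fun _ => sq_nonneg _))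

lemma sqrt_grad_le_normV (u : H1 Ω) :
    √(∫ x in Ω, ‖((√(A x) : ℝ) : ℂ) • u.grad x‖ ^ 2) ≤ normV A V k u :=
  Real.sqrt_le_sqrt (le_add_of_nonneg_left (integral_nonneg fun _ => sq_nonneg _))

/-- The trace inequality in the weighted norm. The constant depends on the lower bounds `Amin`,
`Vmin`, `k₀` and on `Ω`, but on nothing else. -/
lemma IsLipschitzDomain.exists_trace_le_normV (hΩ : IsLipschitzDomain Ω) (hAmin : 0 < Amin)
    (hVmin : 0 < Vmin) {k₀ : ℝ} (hk₀ : 0 < k₀) :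
    ∃ C : ℝ, 0 ≤ C ∧ ∀ (ΓR : Set (EuclideanSpace ℝ (Fin d)))
      (A V β : EuclideanSpace ℝ (Fin d) → ℝ) (Amax βmin βmax Vmax : ℝ),
      CoefficientBounds Ω ΓR Amin Amax βmin βmax Vmin Vmax A V β →
      ∀ k, k₀ ≤ k → ∀ u : H1 Ω, MemLp (trace u) 2 (surfaceMeasure Ω) ∧
        k * ∫ x, ‖trace u x‖ ^ 2 ∂(surfaceMeasure Ω) ≤ C * normV A V k u ^ 2 := by
  obtain ⟨C, hC0, hC⟩ := hΩ.exists_integral_norm_trace_sq_le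
  refine ⟨C * ((k₀ * Vmin ^ 2)⁻¹ + (Vmin * √Amin)⁻¹), by positivity,
    fun ΓR A V β Amax βmin βmax Vmax hc k hk u => ⟨(hC u).1, ?_⟩⟩
  have hk0 : 0 < k := hk₀.trans_le hk
  have hU := (Real.sqrt_le_sqrt (hc.integral_val_sq_le hk0.le u)).trans
    (sqrt_val_le_normV (A := A) u)
  have hG := (Real.sqrt_le_sqrt (hc.integral_grad_sq_le hAmin u)).trans
    (sqrt_grad_le_normV (V := V) (k := k) u)
  rw [← mul_pow, Real.sqrt_mul (by positivity), Real.sqrt_sq (by positivity)] at hU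
  rw [Real.sqrt_mul hAmin.le] at hG
  have h := (hC u).2
  have hUsq := Real.sq_sqrt (integral_nonneg (μ := volume.restrict Ω)
    (fun x => sq_nonneg ‖u.val x‖) : 0 ≤ ∫ x in Ω, ‖u.val x‖ ^ 2)
  rw [← hUsq] at h
  have hU0 := Real.sqrt_nonneg (∫ x in Ω, ‖u.val x‖ ^ 2)
  have hG0 := Real.sqrt_nonneg (∫ x in Ω, ‖u.grad x‖ ^ 2)
  rw [Real.sqrt_sq hU0] at h
  set U := √(∫ x in Ω, ‖u.val x‖ ^ 2)
  set G := √(∫ x in Ω, ‖u.grad x‖ ^ 2)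
  set N := normV A V k u
  have hs : 0 < √Amin := Real.sqrt_pos.2 hAmin
  have h1 : k * U ^ 2 ≤ (k₀ * Vmin ^ 2)⁻¹ * N ^ 2 := by
    rw [le_inv_mul_iff₀ (by positivity)]
    calc k₀ * Vmin ^ 2 * (k * U ^ 2) ≤ k * Vmin ^ 2 * (k * U ^ 2) := by gcongr
      _ = (k * Vmin * U) ^ 2 := by ring
      _ ≤ N ^ 2 := by gcongr
  have h2 : k * (U * G) ≤ (Vmin * √Amin)⁻¹ * N ^ 2 := by
    rw [le_inv_mul_iff₀ (by positivity)]
    calc Vmin * √Amin * (k * (U * G)) = (k * Vmin * U) * (√Amin * G) := by ring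
      _ ≤ N * N := by gcongr; exact le_trans (by positivity) hU
      _ = N ^ 2 := (sq N).symm
  calc k * ∫ x, ‖trace u x‖ ^ 2 ∂(surfaceMeasure Ω) ≤ k * (C * (U ^ 2 + U * G)) := by gcongr
    _ = C * (k * U ^ 2 + k * (U * G)) := by ring
    _ ≤ C * ((k₀ * Vmin ^ 2)⁻¹ * N ^ 2 + (Vmin * √Amin)⁻¹ * N ^ 2) := by gcongr
    _ = _ := by ring

/-! ### The terms of the sesquilinear form -/

lemma norm_sum_mul_conj_le (a b : EuclideanSpace ℂ (Fin d)) :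
    ‖∑ i, a i * conj (b i)‖ ≤ ‖a‖ * ‖b‖ := by
  have h := norm_inner_le_norm (𝕜 := ℂ) b a
  rw [PiLp.inner_apply, mul_comm] at h
  simpa using h

lemma CoefficientBounds.norm_grad_term_le (hAmin : 0 < Amin)
    (hc : CoefficientBounds Ω ΓR Amin Amax βmin βmax Vmin Vmax A V β) (u v : H1 Ω) :
    ‖∫ x in Ω, (A x : ℂ) * ∑ i, u.grad x i * conj (v.grad x i)‖ ≤ normV A V k u * normV A V k v := by
  refine (norm_integral_le_sqrt_mul_sqrt (hc.memLp_sqrt_smul_grad u) (hc.memLp_sqrt_smul_grad v)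
    (fun _ => norm_nonneg _) (fun _ => norm_nonneg _) ?_).trans (mul_le_mul
    (sqrt_grad_le_normV u) (sqrt_grad_le_normV v) (Real.sqrt_nonneg _) (Real.sqrt_nonneg _))
  filter_upwards [hc.bounds_A] with x hx
  have hA : 0 ≤ A x := hAmin.le.trans hx.1
  rw [norm_mul, norm_smul, norm_smul, Complex.norm_real, Complex.norm_real,
    Real.norm_of_nonneg (Real.sqrt_nonneg _), Real.norm_of_nonneg hA]
  calc A x * ‖∑ i, u.grad x i * conj (v.grad x i)‖
      ≤ A x * (‖u.grad x‖ * ‖v.grad x‖) := by gcongr; exact norm_sum_mul_conj_le _ _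
    _ = (√(A x) * √(A x)) * (‖u.grad x‖ * ‖v.grad x‖) := by rw [Real.mul_self_sqrt hA]
    _ = _ := by ring

lemma CoefficientBounds.norm_val_term_le
    (hc : CoefficientBounds Ω ΓR Amin Amax βmin βmax Vmin Vmax A V β) (hk : 0 ≤ k) (u v : H1 Ω) :
    ‖∫ x in Ω, ((k ^ 2 * V x ^ 2 : ℝ) : ℂ) * u.val x * conj (v.val x)‖
      ≤ normV A V k u * normV A V k v := by
  refine (norm_integral_le_sqrt_mul_sqrt (hc.memLp_mul_val hk u) (hc.memLp_mul_val hk v)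
    (fun _ => norm_nonneg _) (fun _ => norm_nonneg _) (ae_of_all _ fun x => le_of_eq ?_)).trans
    (mul_le_mul (sqrt_val_le_normV u) (sqrt_val_le_normV v) (Real.sqrt_nonneg _)
      (Real.sqrt_nonneg _))
  simp only [norm_mul, Complex.norm_real, RCLike.norm_conj, norm_pow]
  ring

lemma CoefficientBounds.norm_robin_term_le (hβmin : 0 < βmin) (hβmax : 0 < βmax)
    (hc : CoefficientBounds Ω ΓR Amin Amax βmin βmax Vmin Vmax A V β) (hk : 0 ≤ k) {u v : H1 Ω}
    (hu : MemLp (trace u) 2 (surfaceMeasure Ω)) (hv : MemLp (trace v) 2 (surfaceMeasure Ω)) :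
    ‖∫ x in ΓR, Complex.I * ((k * β x : ℝ) : ℂ) * trace u x * conj (trace v x)
        ∂(surfaceMeasure Ω)‖ ≤
      √(βmax * (k * ∫ x, ‖trace u x‖ ^ 2 ∂(surfaceMeasure Ω))) *
        √(βmax * (k * ∫ x, ‖trace v x‖ ^ 2 ∂(surfaceMeasure Ω))) := by
  have hbk : 0 ≤ βmax * k := by positivity
  have hmono : ∀ {g : EuclideanSpace ℝ (Fin d) → ℂ}, MemLp g 2 (surfaceMeasure Ω) →
      √(∫ x in ΓR, (√(βmax * k) * ‖g x‖) ^ 2 ∂(surfaceMeasure Ω)) ≤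
        √(βmax * (k * ∫ x, ‖g x‖ ^ 2 ∂(surfaceMeasure Ω))) := fun {g} hg => by
    refine Real.sqrt_le_sqrt ?_
    simp_rw [mul_pow, Real.sq_sqrt hbk]
    rw [integral_const_mul, mul_assoc]
    gcongr βmax * (k * ?_)
    exact setIntegral_le_integral hg.norm.integrable_sq (ae_of_all _ fun _ => sq_nonneg _)
  refine (norm_integral_le_sqrt_mul_sqrt ((hu.restrict ΓR).norm.const_mul √(βmax * k))
    ((hv.restrict ΓR).norm.const_mul √(βmax * k)) (fun _ => by positivity)
    (fun _ => by positivity) ?_).trans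
    (mul_le_mul (hmono hu) (hmono hv) (Real.sqrt_nonneg _) (Real.sqrt_nonneg _))
  filter_upwards [hc.bounds_β] with x hx
  have hβ : 0 ≤ β x := hβmin.le.trans hx.1
  have h2 := hx.2
  rw [norm_mul, norm_mul, norm_mul, Complex.norm_I, one_mul, Complex.norm_real, RCLike.norm_conj,
    Real.norm_of_nonneg (by positivity)]
  calc k * β x * ‖trace u x‖ * ‖trace v x‖ ≤ k * βmax * ‖trace u x‖ * ‖trace v x‖ := by gcongr
    _ = (√(βmax * k) * √(βmax * k)) * ‖trace u x‖ * ‖trace v x‖ := by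
        rw [Real.mul_self_sqrt hbk, mul_comm k]
    _ = _ := by ring

end Helmholtz

theorem theorem3 {d : ℕ} (hd : 1 ≤ d) (Ω : Set (EuclideanSpace ℝ (Fin d)))
    (hΩ : Helmholtz.IsLipschitzDomain Ω)
    (Amin Amax βmin βmax Vmin Vmax k₀ : ℝ)
    (hAmin : 0 < Amin) (hAmax : 0 < Amax) (hβmin : 0 < βmin) (hβmax : 0 < βmax)
    (hVmin : 0 < Vmin) (hVmax : 0 < Vmax) (hk₀ : 0 < k₀) :
    ∃ Ca : ℝ, 0 < Ca ∧
      ∀ ΓD ΓN ΓR : Set (EuclideanSpace ℝ (Fin d)),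
        Helmholtz.IsBoundaryDecomposition Ω ΓD ΓN ΓR →
      ∀ A V β : EuclideanSpace ℝ (Fin d) → ℝ,
        Helmholtz.CoefficientBounds Ω ΓR Amin Amax βmin βmax Vmin Vmax A V β →
      ∀ k : ℝ, k₀ ≤ k →
      ∀ u ∈ Helmholtz.spaceV Ω ΓD, ∀ v ∈ Helmholtz.spaceV Ω ΓD,
        ‖Helmholtz.form ΓR A V β k u v‖
          ≤ Ca * Helmholtz.normV A V k u * Helmholtz.normV A V k v := by
  obtain ⟨C, hC0, hC⟩ := hΩ.exists_trace_le_normV hAmin hVmin hk₀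
  refine ⟨2 + βmax * C, by positivity, fun ΓD ΓN ΓR _ A V β hc k hk u _ v _ => ?_⟩
  have hk0 : 0 ≤ k := hk₀.le.trans hk
  have hN : ∀ u : Helmholtz.H1 Ω, 0 ≤ Helmholtz.normV A V k u := fun u => Real.sqrt_nonneg _
  obtain ⟨hu, hku⟩ := hC ΓR A V β Amax βmin βmax Vmax hc k hk u
  obtain ⟨hv, hkv⟩ := hC ΓR A V β Amax βmin βmax Vmax hc k hk v
  have h1 := hc.norm_grad_term_le (k := k) hAmin u v
  have h2 := hc.norm_val_term_le hk0 u v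
  have h3 := hc.norm_robin_term_le hβmin hβmax hk0 hu hv
  have h4 := mul_le_mul (Real.sqrt_le_sqrt (mul_le_mul_of_nonneg_left hku hβmax.le))
    (Real.sqrt_le_sqrt (mul_le_mul_of_nonneg_left hkv hβmax.le)) (Real.sqrt_nonneg _)
    (Real.sqrt_nonneg _)
  have hs : ∀ N : ℝ, 0 ≤ N → √(βmax * (C * N ^ 2)) = √(βmax * C) * N := fun N hN => by
    rw [← mul_assoc, Real.sqrt_mul (by positivity), Real.sqrt_sq hN]
  rw [hs _ (hN u), hs _ (hN v)] at h4
  have h5 := Real.mul_self_sqrt (show 0 ≤ βmax * C by positivity)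
  unfold Helmholtz.form
  calc _ ≤ Helmholtz.normV A V k u * Helmholtz.normV A V k v +
        Helmholtz.normV A V k u * Helmholtz.normV A V k v +
        √(βmax * C) * Helmholtz.normV A V k u * (√(βmax * C) * Helmholtz.normV A V k v) :=
        (norm_sub_le _ _).trans (add_le_add ((norm_sub_le _ _).trans (add_le_add h1 h2))
          (h3.trans h4))
    _ = (2 + √(βmax * C) * √(βmax * C)) * Helmholtz.normV A V k u * Helmholtz.normV A V k v := by
        ring
    _ = _ := by rw [h5]
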